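/- Let $k$ be a field, $n\ge 0$ an integer and $L$ a lattice in $\mathbb{Z}^n$, that is, a subgroup of $\mathbb{Z}^n$ of any rank. Let $I_L=\langle x^u-x^v : u,v\in\mathbb{N}^n,\ u-v\in L\rangle\subseteq k[x_1,\ldots,x_n]$ be its lattice ideal. Let $\sigma\subseteq\{1,\ldots,n\}$ be the set of all indices $i$ such that $w_i\neq 0$ for some $w\in L\cap\mathbb{N}^n$. For $u\in\mathbb{Z}^n$ put $u^\sigma=(u_i)_{i\notin\sigma}$, let $L^\sigma=\{u^\sigma : u\in L\}\subseteq\mathbb{Z}^{\{1,\ldots,n\}\setminus\sigma}$, and let $I_{L^\sigma}$ be the lattice ideal of $L^\sigma$ (defined in the same way) in the polynomial ring $k[x_i : i\notin\sigma]$. An ideal of height $r$ is called a complete intersection if it is generated by $r$ elements, and an ideal of height $r$ in a polynomial ring is called a binomial complete intersection if it is generated by $r$ binomials, where a binomial is a polynomial of the form $x^u-x^v$. Then $I_L$ is a binomial complete intersection if and only if $I_{L^\sigma}$ is a complete intersection. -/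

import Mathlib

namespace LatticeIdeal

/-- A pure difference binomial `x^u - x^v` in `k[x_i : i ∈ ι]`. -/
def IsBinomial {ι k : Type*} [CommRing k] (f : MvPolynomial ι k) : Prop :=
  ∃ u v : ι →₀ ℕ, f = MvPolynomial.monomial u 1 - MvPolynomial.monomial v 1

/-- The lattice ideal `I_L = ⟨x^u - x^v : u - v ∈ L⟩` of `k[x_i : i ∈ ι]`, where `L` is a
lattice (a subgroup) in `ℤ^ι`. -/
noncomputable def latticeIdeal {ι : Type*} (k : Type*) [CommRing k] (L : AddSubgroup (ι → ℤ)) :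
    Ideal (MvPolynomial ι k) :=
  Ideal.span {f | ∃ u v : ι →₀ ℕ, (fun i => (u i : ℤ) - (v i : ℤ)) ∈ L ∧
    f = MvPolynomial.monomial u 1 - MvPolynomial.monomial v 1}

/-- `σ_L`, the union of the supports of the vectors in `L ∩ ℕ^ι`. -/
def posSupport {ι : Type*} (L : AddSubgroup (ι → ℤ)) : Set ι :=
  {i | ∃ w ∈ L, 0 ≤ w ∧ w i ≠ 0}

/-- For `s ⊆ ι`, the map `u ↦ u^s = (u_i)_{i ∉ s}` that forgets the coordinates in `s`. -/
def forget {ι : Type*} (s : Set ι) : (ι → ℤ) →+ ({i // i ∉ s} → ℤ) where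
  toFun u := fun i => u i.1
  map_zero' := rfl
  map_add' _ _ := rfl

/-- The lattice `L^σ`, `σ = σ_L`: the projection of `L` to the coordinates outside `σ`. -/
def outerLattice {ι : Type*} (L : AddSubgroup (ι → ℤ)) :
    AddSubgroup ({i // i ∉ posSupport L} → ℤ) :=
  L.map (forget (posSupport L))

/-- An ideal of height `r` is a complete intersection if it is generated by `r` elements. -/
def IsCompleteIntersection {R : Type*} [CommRing R] (I : Ideal R) : Prop :=
  ∃ (r : ℕ) (P : Fin r → R), I.height = r ∧ I = Ideal.span (Set.range P)

/-- An ideal of height `r` in a polynomial ring is a binomial complete intersection if it is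
generated by `r` binomials. -/
def IsBinomialCompleteIntersection {ι k : Type*} [CommRing k]
    (I : Ideal (MvPolynomial ι k)) : Prop :=
  ∃ (r : ℕ) (B : Fin r → MvPolynomial ι k),
    (∀ j, IsBinomial (B j)) ∧ I.height = r ∧ I = Ideal.span (Set.range B)

end LatticeIdeal

namespace LatticeIdeal

open MvPolynomial

/-! Let `K` be the part of `L` supported in `σ` (`innerLattice`). It is the kernel of `L → L^σ`, and
the height of a lattice ideal is the rank of its lattice (`height_latticeIdeal`). So the theorem
compares numbers of generators under rank `L` = rank `L^σ` + rank `K`.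

From `I_L` to `I_{L^σ}`: setting the variables in `σ` to `1` maps `I_L` onto a generating set of
`I_{L^σ}` and kills every binomial whose exponent difference lies in `K`. By
`innerLattice_le_closure` these differences generate `K`, so at least rank `K` generators die and at
most rank `L^σ` remain.

From `I_{L^σ}` to `I_L`: `L^σ` contains no nonzero nonnegative vector, so in the grading by cosets
of `L^σ` only constant monomials have degree zero. A graded Nakayama argument then replaces
arbitrary generators by equally many binomials (`exists_binomial_generators`). Lift these to
binomials of `I_L` and add rank `K` binomials whose differences form a basis of `K`. The basis is
chosen so that one added binomial is `x^W - 1` with `W` positive on `σ` (none is needed if `σ` is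
empty). Modulo the ideal the variables in `σ` become units, and cancelling them shows that nothing
of `I_L` is missing (`latticeIdeal_le_of_lifts`).

Membership of binomials is handled throughout by congruences on the monoid of exponents
(`rel_of_mem_span`). -/

/-- The inclusion of exponent vectors `ℕ^ι → ℤ^ι`. -/
def intVec {ι : Type*} : (ι →₀ ℕ) →+ (ι → ℤ) where
  toFun u := fun i => (u i : ℤ)
  map_zero' := by ext; simp
  map_add' u v := by ext; simp

@[simp]
lemma intVec_apply {ι : Type*} (u : ι →₀ ℕ) (i : ι) : intVec u i = (u i : ℤ) := rfl

lemma intVec_injective {ι : Type*} : Function.Injective (intVec : (ι →₀ ℕ) → (ι → ℤ)) := by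
  intro u v h
  ext i
  have := congrFun h i
  simp only [intVec_apply] at this
  exact_mod_cast this

lemma exists_intVec_eq {ι : Type*} [Finite ι] {z : ι → ℤ} (hz : 0 ≤ z) :
    ∃ u : ι →₀ ℕ, intVec u = z := by
  refine ⟨Finsupp.equivFunOnFinite.symm fun i => (z i).toNat, ?_⟩
  ext i
  simpa using hz i

lemma exists_intVec_sub_eq {ι : Type*} [Finite ι] (z : ι → ℤ) :
    ∃ u v : ι →₀ ℕ, intVec u - intVec v = z ∧
      ∀ i, (z i ≤ 0 → u i = 0) ∧ (0 ≤ z i → v i = 0) := by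
  refine ⟨Finsupp.equivFunOnFinite.symm fun i => (z i).toNat,
    Finsupp.equivFunOnFinite.symm fun i => (-z i).toNat, ?_, ?_⟩
  · ext i
    simp only [Pi.sub_apply, intVec_apply, Finsupp.equivFunOnFinite_symm_apply_apply]
    omega
  · intro i
    simp only [Finsupp.equivFunOnFinite_symm_apply_apply]
    omega

/-! ### Binomial ideals and congruences on exponents -/

section Congruence

variable {ι k : Type*} [CommRing k]

/-- The congruence on monomials defined by an ideal. -/
def idealCon (I : Ideal (MvPolynomial ι k)) : AddCon (ι →₀ ℕ) where
  r u v := monomial u (1 : k) - monomial v 1 ∈ I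
  iseqv :=
    { refl := fun u => by simp
      symm := fun {u v} h => by simpa using I.neg_mem h
      trans := fun {u v w} h h' => by simpa using I.add_mem h h' }
  add' := fun {a b c d} h h' => by
    have := I.add_mem (I.mul_mem_left (monomial c (1 : k)) h)
      (I.mul_mem_left (monomial b (1 : k)) h')
    simp only [mul_sub, monomial_mul, mul_one] at this
    rw [add_comm c a, add_comm c b] at this
    simpa using this

lemma idealCon_iff {I : Ideal (MvPolynomial ι k)} {u v : ι →₀ ℕ} :
    idealCon I u v ↔ monomial u (1 : k) - monomial v 1 ∈ I := Iff.rfl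

/-- The congruence on monomials defined by a lattice. -/
def latticeCon (L : AddSubgroup (ι → ℤ)) : AddCon (ι →₀ ℕ) where
  r u v := intVec u - intVec v ∈ L
  iseqv :=
    { refl := fun u => by simp
      symm := fun {u v} h => by simpa using L.neg_mem h
      trans := fun {u v w} h h' => by simpa using L.add_mem h h' }
  add' := fun {a b c d} h h' => by
    have := L.add_mem h h'
    rwa [map_add, map_add, add_sub_add_comm]

lemma latticeCon_iff {L : AddSubgroup (ι → ℤ)} {u v : ι →₀ ℕ} :
    latticeCon L u v ↔ intVec u - intVec v ∈ L := Iff.rfl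

/-- A binomial in an ideal generated by binomials respects every congruence which the generators
respect. -/
lemma rel_of_mem_span [Nontrivial k] (r : AddCon (ι →₀ ℕ)) {S : Set (MvPolynomial ι k)}
    (hS : ∀ f ∈ S, ∃ u v, r u v ∧ f = monomial u 1 - monomial v 1) {a b : ι →₀ ℕ}
    (h : monomial a 1 - monomial b 1 ∈ Ideal.span S) : r a b := by
  -- The map to the monoid algebra of the quotient monoid kills the generators, while monomials from
  -- different classes go to different basis elements.
  let φ : MvPolynomial ι k →+* AddMonoidAlgebra k r.Quotient :=
    AddMonoidAlgebra.mapDomainRingHom k r.mk'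
  have hφ : ∀ u : ι →₀ ℕ, φ (monomial u 1) = AddMonoidAlgebra.single (u : r.Quotient) 1 := by
    intro u
    exact AddMonoidAlgebra.mapDomain_single
  have hle : Ideal.span S ≤ RingHom.ker φ := by
    rw [Ideal.span_le]
    intro f hf
    obtain ⟨u, v, huv, rfl⟩ := hS f hf
    rw [SetLike.mem_coe, RingHom.mem_ker, map_sub, hφ, hφ, (AddCon.eq r).2 huv, sub_self]
  have := hle h
  rw [RingHom.mem_ker, map_sub, hφ, hφ, sub_eq_zero] at this
  rw [← AddCon.eq]
  exact AddMonoidAlgebra.single_left_injective one_ne_zero this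

lemma latticeIdeal_le_iff {L : AddSubgroup (ι → ℤ)} {I : Ideal (MvPolynomial ι k)} :
    latticeIdeal k L ≤ I ↔ ∀ u v, latticeCon L u v → idealCon I u v := by
  rw [latticeIdeal, Ideal.span_le]
  constructor
  · intro h u v huv
    exact h ⟨u, v, huv, rfl⟩
  · rintro h f ⟨u, v, huv, rfl⟩
    exact h u v huv

lemma binomial_mem_latticeIdeal [Nontrivial k] {L : AddSubgroup (ι → ℤ)} {u v : ι →₀ ℕ} :
    monomial u (1 : k) - monomial v 1 ∈ latticeIdeal k L ↔ intVec u - intVec v ∈ L := by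
  constructor
  · intro h
    refine rel_of_mem_span (latticeCon L) ?_ h
    rintro f ⟨u, v, huv, rfl⟩
    exact ⟨u, v, huv, rfl⟩
  · intro h
    exact Ideal.subset_span ⟨u, v, h, rfl⟩

end Congruence

/-! ### Independent variables modulo a prime -/

/-- A prime of height `h` in a polynomial ring in `n` variables over a field meets the polynomial
ring in some `n - h` of the variables trivially. -/
lemma exists_independent_variables_fin {k : Type*} [Field k] (n : ℕ) :
    ∀ (P : Ideal (MvPolynomial (Fin n) k)) [P.IsPrime], ∃ S : Finset (Fin n),
      (n : ℕ∞) ≤ S.card + P.height ∧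
        ∀ f ∈ P, (∀ m ∈ f.support, ∀ i, i ∉ S → m i = 0) → f = 0 := by
  induction n with
  | zero =>
    intro P hP
    refine ⟨∅, by simp, fun f hf _ => ?_⟩
    by_contra hne
    refine hP.ne_top (Ideal.eq_top_of_isUnit_mem _ hf ?_)
    obtain ⟨c, rfl⟩ := C_surjective (R := k) (Fin 0) f
    exact (isUnit_iff_ne_zero.2 fun h => hne (by simp [h])).map C
  | succ n ih =>
    intro P hP
    let e : MvPolynomial (Fin (n + 1)) k ≃+* Polynomial (MvPolynomial (Fin n) k) :=
      (finSuccEquiv k n).toRingEquiv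
    have hcoeff : ∀ f i m, coeff m (Polynomial.coeff (e f) i) = coeff (m.cons i) f :=
      fun f i m => finSuccEquiv_coeff_coeff m f i
    let Q : Ideal (Polynomial (MvPolynomial (Fin n) k)) := P.comap e.symm
    have hQ : Q.IsPrime := Ideal.comap_isPrime _ _
    have hQh : Q.height = P.height := e.symm.height_comap P
    have hPQ : ∀ f ∈ P, e f ∈ Q := fun f hf => by simpa [Q, Ideal.mem_comap] using hf
    let p : Ideal (MvPolynomial (Fin n) k) := Q.comap Polynomial.C
    have hp : p.IsPrime := Ideal.comap_isPrime _ _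
    obtain ⟨S, hS, hSp⟩ := ih p
    have hlies : ∀ (A : Ideal (Polynomial (MvPolynomial (Fin n) k))) [A.IsPrime],
        A.comap Polynomial.C = p → p.height ≤ A.height := by
      intro A _ hA
      have : A.LiesOver p := ⟨hA.symm⟩
      rw [Ideal.height_eq_height_add_of_liesOver_of_hasGoingDown p A]
      exact le_self_add
    -- If the prime is extended from its contraction `p`, variable `0` is independent as well;
    -- otherwise it lies strictly above `p[X]`, and the gain of one in height pays for losing
    -- variable `0`.
    by_cases hpQ : p.map Polynomial.C = Q
    · refine ⟨Finset.cons 0 (S.map (Fin.succEmb n)) (by simp), ?_, ?_⟩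
      · have := hlies Q rfl
        rw [Finset.card_cons, Finset.card_map]
        push_cast
        calc (n : ℕ∞) + 1 ≤ S.card + p.height + 1 := by gcongr
          _ ≤ S.card + P.height + 1 := by rw [← hQh]; gcongr
          _ = _ := by ring
      · intro f hf hsupp
        have hef := hPQ f hf
        rw [← hpQ, Ideal.mem_map_C_iff] at hef
        apply e.injective
        rw [map_zero]
        ext1 i
        rw [Polynomial.coeff_zero]
        refine hSp _ (hef i) fun m hm j hj => ?_
        rw [mem_support_iff, hcoeff] at hm
        simpa using hsupp _ (mem_support_iff.2 hm) j.succ (by simpa using hj)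
    · refine ⟨S.map (Fin.succEmb n), ?_, ?_⟩
      · have hle : p.map Polynomial.C ≤ Q := Ideal.map_comap_le
        have hprime : (p.map Polynomial.C).IsPrime := Ideal.isPrime_map_C_of_isPrime
        have h1 := Ideal.height_add_one_le_of_lt_of_isPrime (lt_of_le_of_ne hle hpQ)
        have h2 := hlies (p.map Polynomial.C)
          (le_antisymm (Ideal.comap_mono hle) Ideal.le_comap_map)
        rw [Finset.card_map]
        push_cast
        calc (n : ℕ∞) + 1 ≤ S.card + p.height + 1 := by gcongr
          _ = S.card + (p.height + 1) := by ring
          _ ≤ S.card + ((p.map Polynomial.C).height + 1) := by gcongr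
          _ ≤ S.card + P.height := by rw [← hQh]; gcongr
      · intro f hf hsupp
        have hdeg : e f = Polynomial.C ((e f).coeff 0) := by
          ext1 i
          rw [Polynomial.coeff_C]
          split_ifs with hi
          · rw [hi]
          · ext m
            rw [hcoeff, coeff_zero]
            by_contra hne
            exact hi (by simpa using hsupp _ (mem_support_iff.2 hne) 0 (by simp))
        have hmem : (e f).coeff 0 ∈ p := by
          rw [Ideal.mem_comap, ← hdeg]
          exact hPQ f hf
        have h0 : (e f).coeff 0 = 0 := by
          refine hSp _ hmem fun m hm j hj => ?_
          rw [mem_support_iff, hcoeff] at hm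
          simpa using hsupp _ (mem_support_iff.2 hm) j.succ (by simpa using hj)
        apply e.injective
        rw [hdeg, h0, map_zero, map_zero]

lemma exists_independent_variables {ι k : Type*} [Fintype ι] [Field k]
    (P : Ideal (MvPolynomial ι k)) [P.IsPrime] : ∃ S : Finset ι,
      (Fintype.card ι : ℕ∞) ≤ S.card + P.height ∧
        ∀ f ∈ P, (∀ m ∈ f.support, ∀ i, i ∉ S → m i = 0) → f = 0 := by
  classical
  let e := Fintype.equivFin ι
  let E : MvPolynomial ι k ≃+* MvPolynomial (Fin (Fintype.card ι)) k :=
    (renameEquiv k e).toRingEquiv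
  have hE : ∀ f, E f = rename e f := fun f => rfl
  let Q := P.comap E.symm
  have hQ : Q.IsPrime := Ideal.comap_isPrime _ _
  have hQh : Q.height = P.height := E.symm.height_comap P
  obtain ⟨S, hS, hSQ⟩ := exists_independent_variables_fin _ Q
  refine ⟨S.map e.symm.toEmbedding, ?_, ?_⟩
  · rwa [Finset.card_map, ← hQh]
  · intro f hf hsupp
    apply E.injective
    rw [map_zero]
    refine hSQ _ (by simpa [Q, Ideal.mem_comap] using hf) fun m hm i hi => ?_
    rw [hE, support_rename_of_injective e.injective, Finset.mem_image] at hm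
    obtain ⟨m', hm', rfl⟩ := hm
    rw [Finsupp.mapDomain_equiv_apply]
    refine hsupp m' hm' _ fun h => hi ?_
    simpa using h

/-! ### Generators and bases of a lattice -/

section Rank

variable {ι : Type*}

instance [Finite ι] (L : AddSubgroup (ι → ℤ)) : Module.Finite ℤ L :=
  inferInstanceAs (Module.Finite ℤ (AddSubgroup.toIntSubmodule L))

instance [Finite ι] (L : AddSubgroup (ι → ℤ)) : Module.Free ℤ L :=
  inferInstanceAs (Module.Free ℤ (AddSubgroup.toIntSubmodule L))

/-- A congruence which relates the two sides of generators of a lattice, and from which the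
generators' exponents can be cancelled, relates the two sides of all vectors of the lattice. -/
lemma rel_of_mem_closure (r : AddCon (ι →₀ ℕ)) (M : AddSubmonoid (ι →₀ ℕ))
    (hM : ∀ c ∈ M, ∀ u v, r (u + c) (v + c) → r u v) {Z : Set (ι → ℤ)}
    (hZ : ∀ z ∈ Z, ∃ u ∈ M, ∃ v ∈ M, intVec u - intVec v = z ∧ r u v) {u v : ι →₀ ℕ}
    (h : intVec u - intVec v ∈ AddSubgroup.closure Z) : r u v := by
  have key : ∀ z ∈ AddSubgroup.closure Z,
      ∃ u ∈ M, ∃ v ∈ M, intVec u - intVec v = z ∧ r u v := by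
    intro z hz
    induction hz using AddSubgroup.closure_induction with
    | mem z hz => exact hZ z hz
    | zero => exact ⟨0, M.zero_mem, 0, M.zero_mem, by simp, r.refl 0⟩
    | add y z _ _ hy hz =>
      obtain ⟨a, ha, b, hb, rfl, hab⟩ := hy
      obtain ⟨c, hc, d, hd, rfl, hcd⟩ := hz
      exact ⟨a + c, M.add_mem ha hc, b + d, M.add_mem hb hd,
        by rw [map_add, map_add, add_sub_add_comm], r.add hab hcd⟩
    | neg z _ hz =>
      obtain ⟨a, ha, b, hb, rfl, hab⟩ := hz
      exact ⟨b, hb, a, ha, by simp, r.symm hab⟩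
  -- Here `u - v = a - b`, so `u + b = a + v` is related to `b + v`, and `b ∈ M` cancels.
  obtain ⟨a, -, b, hb, hz, hab⟩ := key _ h
  refine hM b hb u v ?_
  have hsum : u + b = a + v := by
    apply intVec_injective
    rw [map_add, map_add, ← sub_eq_zero]
    rw [← sub_eq_zero] at hz
    rw [← neg_eq_zero, ← hz]
    abel
  rw [hsum, add_comm v b]
  exact r.add hab (r.refl v)

/-- A basis of a lattice spans it as a group. -/
lemma closure_range_basis {κ : Type*} {L : AddSubgroup (ι → ℤ)} (b : Module.Basis κ ℤ L) :
    AddSubgroup.closure (Set.range fun j => (b j : ι → ℤ)) = L := by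
  have h := b.span_eq
  rw [← AddSubgroup.toIntSubmodule_closure] at h
  have h' : AddSubgroup.closure (Set.range b) = ⊤ := AddSubgroup.toIntSubmodule.injective h
  have h2 := congrArg (AddSubgroup.map L.subtype) h'
  rw [AddMonoidHom.map_closure, ← Set.range_comp, ← AddMonoidHom.range_eq_map,
    AddSubgroup.range_subtype] at h2
  exact h2

end Rank

/-! ### The height of a lattice ideal -/

section Height

variable {ι k : Type*} [Fintype ι] [Field k]

/-- Given a set `S` of variables independent modulo a minimal prime `P`, a vector of `L` supported
in `S` yields a binomial of `P` in those variables, which must be zero. So `L` embeds in the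
coordinates outside `S`, of which there are at most `P.height`. -/
lemma finrank_le_height_latticeIdeal (L : AddSubgroup (ι → ℤ)) :
    (Module.finrank ℤ L : ℕ∞) ≤ (latticeIdeal k L).height := by
  classical
  rw [Ideal.height_eq_inf_minimalPrimes]
  refine le_iInf₂ fun P hP => ?_
  have := hP.isPrime
  obtain ⟨S, hS, hSP⟩ := exists_independent_variables P
  let ρ : L →ₗ[ℤ] ({i // i ∉ S} → ℤ) :=
    ((forget {i | i ∈ S}).comp L.subtype).toIntLinearMap
  have hρ : ∀ z i, ρ z i = (z : ι → ℤ) i.1 := fun z i => rfl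
  have hinj : Function.Injective ρ := by
    rw [injective_iff_map_eq_zero]
    intro z hz
    obtain ⟨u, v, huv, hsupp⟩ := exists_intVec_sub_eq (z : ι → ℤ)
    have hmem : monomial u (1 : k) - monomial v 1 ∈ P := by
      refine hP.le (binomial_mem_latticeIdeal.2 ?_)
      rw [huv]
      exact z.2
    have hz' : ∀ i, i ∉ S → u i = 0 ∧ v i = 0 := by
      intro i hi
      have hzi : (z : ι → ℤ) i = 0 := by rw [← hρ z ⟨i, hi⟩, hz, Pi.zero_apply]
      exact ⟨(hsupp i).1 hzi.le, (hsupp i).2 hzi.ge⟩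
    have h0 := hSP _ hmem fun m hm i hi => by
      rcases Finset.mem_union.1 (support_sub _ _ _ hm) with h | h
      · rw [Finset.mem_singleton.1 (support_monomial_subset h)]
        exact (hz' i hi).1
      · rw [Finset.mem_singleton.1 (support_monomial_subset h)]
        exact (hz' i hi).2
    rw [sub_eq_zero] at h0
    have huv' : u = v := monomial_left_injective one_ne_zero h0
    apply Subtype.ext
    rw [← huv, huv', sub_self]
    rfl
  have hle := LinearMap.finrank_le_finrank_of_injective hinj
  rw [Module.finrank_fintype_fun_eq_card, Fintype.card_subtype_compl, Fintype.card_coe] at hle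
  have hcard := S.card_le_univ
  have hsum : Module.finrank ℤ L + S.card ≤ Fintype.card ι := by omega
  have : ((Module.finrank ℤ L : ℕ) : ℕ∞) + S.card ≤ P.height + S.card := by
    rw [add_comm P.height]
    exact le_trans (by exact_mod_cast hsum) hS
  exact (ENat.add_le_add_iff_right (ENat.natCast_ne_top _)).1 this

/-- Binomials of a lattice basis need not generate `I_L`, but a minimal prime over them that
contains no monomial does contain `I_L`; Krull's height theorem bounds its height. -/
lemma height_latticeIdeal_le_finrank (L : AddSubgroup (ι → ℤ)) :
    (latticeIdeal k L).height ≤ (Module.finrank ℤ L : ℕ∞) := by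
  classical
  let b := Module.finBasis ℤ L
  choose u v huv hsupp using fun j => exists_intVec_sub_eq (b j : ι → ℤ)
  let B : Fin (Module.finrank ℤ L) → MvPolynomial ι k := fun j => monomial (u j) 1 - monomial (v j) 1
  -- The ideal of the point `(1, …, 1)` contains every binomial and no monomial, so monomials cancel
  -- modulo any prime below it.
  let m : Ideal (MvPolynomial ι k) := RingHom.ker (eval fun _ => (1 : k))
  have hm : m.IsPrime := RingHom.ker_isPrime _
  have hBm : Ideal.span (Set.range B) ≤ m := by
    rw [Ideal.span_le]
    rintro _ ⟨j, rfl⟩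
    simp [m, B, RingHom.mem_ker, eval_monomial]
  obtain ⟨P, hP, hPm⟩ := Ideal.exists_minimalPrimes_le hBm
  have hPprime := hP.isPrime
  have hLP : latticeIdeal k L ≤ P := by
    rw [latticeIdeal_le_iff]
    intro x y hxy
    refine rel_of_mem_closure (idealCon P) ⊤ ?_ ?_ (Z := Set.range fun j => (b j : ι → ℤ)) ?_
    · intro c _ x y h
      rw [idealCon_iff] at h ⊢
      have : (monomial x (1 : k) - monomial y 1) * monomial c 1 ∈ P := by
        simpa [sub_mul, monomial_mul] using h
      refine (hPprime.mem_or_mem this).resolve_right fun hc => ?_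
      simpa [m, RingHom.mem_ker, eval_monomial] using hPm hc
    · rintro _ ⟨j, rfl⟩
      exact ⟨u j, trivial, v j, trivial, huv j, hP.le (Ideal.subset_span ⟨j, rfl⟩)⟩
    · rw [closure_range_basis]
      exact hxy
  calc (latticeIdeal k L).height ≤ P.height := Ideal.height_mono hLP
    _ ≤ (Set.range B).ncard :=
      Ideal.height_le_card_of_mem_minimalPrimes_span (Set.finite_range B) hP
    _ ≤ _ := by
      rw [← Set.image_univ]
      have := Set.ncard_image_le (f := B) (Set.finite_univ (α := Fin (Module.finrank ℤ L)))
      rw [Set.ncard_univ, Nat.card_fin] at this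
      exact_mod_cast this

/-- The height of a lattice ideal is the rank of the lattice. -/
theorem height_latticeIdeal (L : AddSubgroup (ι → ℤ)) :
    (latticeIdeal k L).height = (Module.finrank ℤ L : ℕ∞) :=
  le_antisymm (height_latticeIdeal_le_finrank L) (finrank_le_height_latticeIdeal L)

end Height

/-! ### The grading by cosets of the lattice -/

section Graded

variable {ι k : Type*} [Field k]

/-- The weights of the grading of `k[x]` by `ℤ^ι / L`. -/
noncomputable def latticeWeight (L : AddSubgroup (ι → ℤ)) [DecidableEq ι] (i : ι) : (ι → ℤ) ⧸ L :=
  QuotientAddGroup.mk (Pi.single i 1)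

lemma weight_latticeWeight [Fintype ι] [DecidableEq ι] (L : AddSubgroup (ι → ℤ)) (u : ι →₀ ℕ) :
    Finsupp.weight (latticeWeight L) u = QuotientAddGroup.mk (intVec u) := by
  rw [Finsupp.weight_apply, Finsupp.sum_fintype _ _ (by simp)]
  have : intVec u = ∑ i, u i • (Pi.single i 1 : ι → ℤ) := by
    ext i
    simp [Finset.sum_apply, Pi.single_apply]
  rw [this, ← QuotientAddGroup.mk'_apply, map_sum]
  simp [latticeWeight]

lemma weightedHomogeneousComponent_monomial {M : Type*} [AddCommMonoid M] [DecidableEq M]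
    (w : ι → M) (a : M) (d : ι →₀ ℕ) (c : k) :
    weightedHomogeneousComponent w a (monomial d c) =
      if Finsupp.weight w d = a then monomial d c else 0 := by
  classical
  ext e
  rw [coeff_weightedHomogeneousComponent]
  split_ifs with h1 h2 h2
  · rfl
  · rw [coeff_monomial, if_neg, coeff_zero]
    rintro rfl
    exact h2 h1
  · rw [coeff_monomial, if_neg]
    rintro rfl
    exact h1 h2
  · rfl

/-- An ideal generated by binomials of a lattice is homogeneous for the grading by the cosets of
the lattice. -/
lemma weightedHomogeneousComponent_mem [Fintype ι] [DecidableEq ι] {L : AddSubgroup (ι → ℤ)} {κ : Type*}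
    [Fintype κ] {u v : κ → ι →₀ ℕ} (huv : ∀ j, intVec (u j) - intVec (v j) ∈ L)
    {f : MvPolynomial ι k}
    (hf : f ∈ Ideal.span (Set.range fun j => monomial (u j) (1 : k) - monomial (v j) 1))
    (a : (ι → ℤ) ⧸ L) :
    weightedHomogeneousComponent (latticeWeight L) a f ∈
      Ideal.span (Set.range fun j => monomial (u j) (1 : k) - monomial (v j) 1) := by
  classical
  obtain ⟨c, rfl⟩ := Ideal.mem_span_range_iff_exists_fun.1 hf
  rw [map_sum]
  refine Ideal.sum_mem _ fun j _ => ?_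
  generalize c j = p
  induction p using MvPolynomial.induction_on' with
  | add p q hp hq =>
    rw [add_mul, map_add]
    exact Ideal.add_mem _ hp hq
  | monomial t s =>
    have hmem : monomial t s * (monomial (u j) (1 : k) - monomial (v j) 1) ∈
        Ideal.span (Set.range fun j => monomial (u j) (1 : k) - monomial (v j) 1) :=
      Ideal.mul_mem_left _ _ (Ideal.subset_span ⟨j, rfl⟩)
    have hw : Finsupp.weight (latticeWeight L) (t + u j) =
        Finsupp.weight (latticeWeight L) (t + v j) := by
      rw [map_add, map_add, weight_latticeWeight, weight_latticeWeight L (u j),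
        weight_latticeWeight L (v j), add_right_inj, QuotientAddGroup.eq]
      simpa [neg_add_eq_sub] using L.neg_mem (huv j)
    rw [mul_sub, monomial_mul, monomial_mul] at hmem ⊢
    rw [map_sub, weightedHomogeneousComponent_monomial, weightedHomogeneousComponent_monomial, hw]
    split_ifs
    · exact hmem
    · simp

/-- A monomial `x^t` has degree zero only if `t ∈ L`, which forces `t = 0`; hence only the constant
term of `f` preserves the degree of the binomial. -/
lemma weightedHomogeneousComponent_mul_binomial [Fintype ι] [DecidableEq ι] {L : AddSubgroup (ι → ℤ)}
    (hL : ∀ w ∈ L, 0 ≤ w → w = 0) {x y : ι →₀ ℕ} (hxy : intVec x - intVec y ∈ L)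
    (f : MvPolynomial ι k) :
    weightedHomogeneousComponent (latticeWeight L) (Finsupp.weight (latticeWeight L) x)
        (f * (monomial x 1 - monomial y 1)) =
      C (constantCoeff f) * (monomial x 1 - monomial y 1) := by
  classical
  have hw : Finsupp.weight (latticeWeight L) y = Finsupp.weight (latticeWeight L) x := by
    rw [weight_latticeWeight, weight_latticeWeight L x, QuotientAddGroup.eq]
    simpa [neg_add_eq_sub] using hxy
  induction f using MvPolynomial.induction_on' with
  | add p q hp hq => rw [add_mul, map_add, hp, hq, map_add, C_add, add_mul]
  | monomial t s =>
    rw [mul_sub, monomial_mul, monomial_mul, map_sub, weightedHomogeneousComponent_monomial,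
      weightedHomogeneousComponent_monomial, map_add, map_add, hw, ← mul_one s]
    by_cases ht : t = 0
    · subst ht
      simp [mul_sub, C_mul_monomial]
    · have hne : Finsupp.weight (latticeWeight L) t ≠ 0 := by
        rw [weight_latticeWeight, Ne, QuotientAddGroup.eq_zero_iff]
        intro h
        refine ht (intVec_injective ?_)
        rw [hL _ h fun i => by simp, map_zero]
      rw [if_neg (by simpa using hne), if_neg (by simpa using hne), constantCoeff_monomial, if_neg ht]
      simp

end Graded

/-! ### Nakayama's lemma and binomial generators -/

section Generators

variable {ι k : Type*} [Field k]

/-- Modulo `m I`, where `m` is the ideal of the origin, the `R`-span and the `k`-span of a set of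
generators of `I` agree. -/
lemma map_mkQ_span_eq (B : Set (MvPolynomial ι k)) {I : Ideal (MvPolynomial ι k)}
    (hI : I = Ideal.span B) :
    (I.restrictScalars k).map
        ((RingHom.ker (constantCoeff (R := k) (σ := ι)) * I).restrictScalars k).mkQ =
      Submodule.span k
        (((RingHom.ker (constantCoeff (R := k) (σ := ι)) * I).restrictScalars k).mkQ '' B) := by
  set q := ((RingHom.ker (constantCoeff (R := k) (σ := ι)) * I).restrictScalars k).mkQ with hq
  apply le_antisymm
  · rw [Submodule.map_le_iff_le_comap]
    intro x hx
    have hx' : x ∈ Submodule.span (MvPolynomial ι k) B := by rw [hI] at hx; exact hx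
    rw [Submodule.mem_comap]
    induction hx' using Submodule.span_induction with
    | mem x h => exact Submodule.subset_span ⟨x, h, rfl⟩
    | zero =>
      rw [map_zero]
      exact Submodule.zero_mem _
    | add x y hx hy h h' =>
      rw [map_add]
      refine Submodule.add_mem _ (h ?_) (h' ?_) <;> rw [hI] <;> assumption
    | smul a x hxB h =>
      have hxI : x ∈ I := by rw [hI]; exact hxB
      have : q (a • x) = constantCoeff a • q x := by
        rw [← map_smul, ← sub_eq_zero, ← map_sub, hq, Submodule.mkQ_apply,
          Submodule.Quotient.mk_eq_zero]
        rw [Submodule.restrictScalars_mem, smul_eq_mul, smul_eq_C_mul, ← sub_mul]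
        exact Ideal.mul_mem_mul (by simp [RingHom.mem_ker]) hxI
      rw [this]
      exact Submodule.smul_mem _ _ (h hxI)
  · rw [Submodule.span_le]
    rintro _ ⟨x, hx, rfl⟩
    exact ⟨x, by rw [hI]; exact Ideal.subset_span hx, rfl⟩

/-- From a generating set of an ideal with `m` generators one can select at most `m` elements that
generate the ideal locally at the origin. -/
lemma exists_subset_generating_modulo {m : ℕ} {I : Ideal (MvPolynomial ι k)}
    {f : Fin m → MvPolynomial ι k} (hf : I = Ideal.span (Set.range f))
    {B : Set (MvPolynomial ι k)} (hB : I = Ideal.span B) (h0 : 0 ∈ B) :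
    ∃ g : Fin m → MvPolynomial ι k, (∀ j, g j ∈ B) ∧
      I ≤ Ideal.span (Set.range g) ⊔ RingHom.ker (constantCoeff (R := k) (σ := ι)) • I := by
  classical
  have hfq := map_mkQ_span_eq _ hf
  have hBq := map_mkQ_span_eq _ hB
  set q := ((RingHom.ker (constantCoeff (R := k) (σ := ι)) * I).restrictScalars k).mkQ with hq
  obtain ⟨b, hbB, hbspan, hb⟩ := exists_linearIndependent k (q '' B)
  have hfin : (q '' Set.range f).Finite := (Set.finite_range f).image q
  have := hfin.fintype
  have hcard : Cardinal.mk b ≤ m := by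
    refine (linearIndependent_le_span' _ hb (q '' Set.range f) ?_).trans ?_
    · rw [Subtype.range_coe, ← hfq, hBq, ← hbspan]
      exact Submodule.subset_span
    · rw [Nat.cast_le, ← Set.toFinset_card, ← Set.ncard_eq_toFinset_card',
        ← Set.range_comp, ← Set.image_univ]
      have := Set.ncard_image_le (f := q ∘ f) (Set.finite_univ (α := Fin m))
      rwa [Set.ncard_univ, Nat.card_fin] at this
  have hbfin : Finite b := Cardinal.lt_aleph0_iff_finite.1 (hcard.trans_lt Cardinal.natCast_lt_aleph0)
  have := Fintype.ofFinite b
  rw [Cardinal.mk_fintype, Nat.cast_le] at hcard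
  obtain ⟨e⟩ := Function.Embedding.nonempty_of_card_le (hcard.trans_eq (Fintype.card_fin m).symm)
  choose s hsB hsq using fun x : b => hbB x.2
  -- Indices not needed for the basis `b` receive the generator `0`, which is why `0 ∈ B` is
  -- required.
  refine ⟨Function.extend e s 0, fun j => ?_, fun x hx => ?_⟩
  · by_cases hj : ∃ x, e x = j
    · obtain ⟨x, rfl⟩ := hj
      rw [e.injective.extend_apply]
      exact hsB x
    · rw [Function.extend_apply' _ _ _ hj]
      exact h0
  · have hqx : q x ∈ Submodule.span k b := by
      rw [hbspan, ← hBq]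
      exact ⟨x, hx, rfl⟩
    have hle : Submodule.span k b ≤
        ((Ideal.span (Set.range (Function.extend e s 0))).restrictScalars k).map q := by
      rw [Submodule.span_le]
      intro y hy
      refine ⟨s ⟨y, hy⟩, Ideal.subset_span ⟨e ⟨y, hy⟩, ?_⟩, hsq ⟨y, hy⟩⟩
      rw [e.injective.extend_apply]
    obtain ⟨y, hy, hyx⟩ := hle hqx
    rw [eq_comm, ← sub_eq_zero, ← map_sub, hq, Submodule.mkQ_apply,
      Submodule.Quotient.mk_eq_zero] at hyx
    rw [← add_sub_cancel y x]
    exact Submodule.add_mem_sup hy hyx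

/-- If a lattice has no nonzero nonnegative vector, then as many binomials as there are elements in
any given generating set generate the lattice ideal. -/
lemma exists_binomial_generators [Fintype ι] {L : AddSubgroup (ι → ℤ)}
    (hL : ∀ w ∈ L, 0 ≤ w → w = 0) {m : ℕ} {f : Fin m → MvPolynomial ι k}
    (hf : latticeIdeal k L = Ideal.span (Set.range f)) :
    ∃ u v : Fin m → ι →₀ ℕ, (∀ j, intVec (u j) - intVec (v j) ∈ L) ∧
      latticeIdeal k L =
        Ideal.span (Set.range fun j => monomial (u j) (1 : k) - monomial (v j) 1) := by
  classical
  obtain ⟨g, hg, hle⟩ := exists_subset_generating_modulo hf (B := {f | ∃ u v : ι →₀ ℕ,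
    (fun i => (u i : ℤ) - (v i : ℤ)) ∈ L ∧ f = monomial u 1 - monomial v 1}) rfl
    ⟨0, 0, (latticeCon L).refl 0, by simp⟩
  choose u v huv hguv using hg
  obtain rfl : g = fun j => monomial (u j) (1 : k) - monomial (v j) 1 := funext hguv
  refine ⟨u, v, huv, le_antisymm ?_ ?_⟩
  -- Nakayama gives `r` with constant term `1` that multiplies `I_L` into the span of the binomials;
  -- the homogeneous component in the degree of a given binomial then removes `r`.
  · obtain ⟨r, hr, hrI⟩ := Submodule.exists_sub_one_mem_and_smul_le_of_fg_of_le_sup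
      (IsNoetherian.noetherian (latticeIdeal k L)) le_rfl hle
    rw [latticeIdeal_le_iff]
    intro x y hxy
    have hmem : r * (monomial x (1 : k) - monomial y 1) ∈
        Ideal.span (Set.range fun j => monomial (u j) (1 : k) - monomial (v j) 1) :=
      hrI (Submodule.smul_mem_pointwise_smul _ r _ (binomial_mem_latticeIdeal.2 hxy))
    have h := weightedHomogeneousComponent_mem huv hmem
      (Finsupp.weight (latticeWeight L) x)
    rw [weightedHomogeneousComponent_mul_binomial hL hxy] at h
    have hr1 : constantCoeff r = 1 := by
      rwa [RingHom.mem_ker, map_sub, map_one, sub_eq_zero] at hr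
    rw [hr1, C_1, one_mul] at h
    exact h
  · rw [Ideal.span_le]
    rintro _ ⟨j, rfl⟩
    exact binomial_mem_latticeIdeal.2 (huv j)

end Generators

/-! ### The lattices inside and outside `σ` -/

section Lattices

variable {ι : Type*}

/-- The vectors of `L` supported in `σ_L`. -/
def innerLattice (L : AddSubgroup (ι → ℤ)) : AddSubgroup (ι → ℤ) :=
  L ⊓ (forget (posSupport L)).ker

lemma mem_innerLattice {L : AddSubgroup (ι → ℤ)} {z : ι → ℤ} :
    z ∈ innerLattice L ↔ z ∈ L ∧ ∀ i, i ∉ posSupport L → z i = 0 := by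
  rw [innerLattice, AddSubgroup.mem_inf, AddMonoidHom.mem_ker, funext_iff, Subtype.forall]
  rfl

lemma eq_zero_of_notMem_posSupport {L : AddSubgroup (ι → ℤ)} {w : ι → ℤ} (hw : w ∈ L)
    (h0 : 0 ≤ w) {i : ι} (hi : i ∉ posSupport L) : w i = 0 := by
  by_contra h
  exact hi ⟨w, hw, h0, h⟩

lemma exists_full_support [Finite ι] (L : AddSubgroup (ι → ℤ)) :
    ∃ w ∈ L, 0 ≤ w ∧ ∀ i ∈ posSupport L, 0 < w i := by
  classical
  have := Fintype.ofFinite ι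
  choose! f hfL hf0 hf using fun i (hi : i ∈ posSupport L) => hi
  refine ⟨∑ i with i ∈ posSupport L, f i, L.sum_mem fun i hi => hfL i (by simpa using hi),
    Finset.sum_nonneg fun i hi => hf0 i (by simpa using hi), fun i hi => ?_⟩
  rw [Finset.sum_apply]
  refine Finset.sum_pos' (fun j hj => hf0 j (by simpa using hj) i) ⟨i, by simpa using hi, ?_⟩
  exact lt_of_le_of_ne (hf0 i hi i) (hf i hi).symm

/-- The lattice `L^σ` has no nonzero nonnegative vector. -/
lemma eq_zero_of_mem_outerLattice [Finite ι] {L : AddSubgroup (ι → ℤ)}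
    {z : {i // i ∉ posSupport L} → ℤ} (hz : z ∈ outerLattice L) (h0 : 0 ≤ z) : z = 0 := by
  have := Fintype.ofFinite ι
  obtain ⟨u, hu, rfl⟩ := hz
  obtain ⟨w, hw, hw0, hpos⟩ := exists_full_support L
  ext ⟨i, hi⟩
  -- The multiple of `w` outweighs any negative entry on `σ`, where `w ≥ 1`; the sum is then
  -- nonnegative, so it vanishes outside `σ`, and so does `w`.
  have hmem : u + (∑ j, |u j|) • w ∈ L := L.add_mem hu (L.zsmul_mem hw _)
  have hnn : 0 ≤ u + (∑ j, |u j|) • w := by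
    intro j
    have hS : |u j| ≤ ∑ j, |u j| :=
      Finset.single_le_sum (f := fun j => |u j|) (fun j _ => abs_nonneg (u j)) (Finset.mem_univ j)
    have hSn : 0 ≤ ∑ j, |u j| := (abs_nonneg _).trans hS
    simp only [Pi.zero_apply, Pi.add_apply, Pi.smul_apply, smul_eq_mul]
    by_cases hj : j ∈ posSupport L
    · have := hpos j hj
      have h1 := neg_abs_le (u j)
      nlinarith
    · have h1 : 0 ≤ u j := h0 ⟨j, hj⟩
      have h2 := hw0 j
      have := mul_nonneg hSn h2
      linarith
  have := eq_zero_of_notMem_posSupport hmem hnn hi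
  rw [Pi.add_apply, Pi.smul_apply, eq_zero_of_notMem_posSupport hw hw0 hi] at this
  simpa [forget] using this

lemma finrank_eq_outer_add_inner [Finite ι] (L : AddSubgroup (ι → ℤ)) :
    Module.finrank ℤ L =
      Module.finrank ℤ (outerLattice L) + Module.finrank ℤ (innerLattice L) := by
  let g : L →ₗ[ℤ] outerLattice L :=
    ((forget (posSupport L)).addSubgroupMap L).toIntLinearMap
  have hg : Function.Surjective g := (forget (posSupport L)).addSubgroupMap_surjective L
  have hrank := (LinearMap.ker g).finrank_quotient_add_finrank
  rw [(g.quotKerEquivOfSurjective hg).finrank_eq] at hrank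
  rw [← hrank]
  congr 1
  let e : LinearMap.ker g ≃+ innerLattice L :=
    { toFun := fun x => ⟨x.1.1, x.1.2, congrArg Subtype.val x.2⟩
      invFun := fun x => ⟨⟨x.1, x.2.1⟩, Subtype.ext x.2.2⟩
      left_inv := fun x => rfl
      right_inv := fun x => rfl
      map_add' := fun x y => rfl }
  exact e.toIntLinearEquiv.finrank_eq

lemma finrank_le_card_of_le_closure [Finite ι] {κ : Type*} [Fintype κ] {K : AddSubgroup (ι → ℤ)}
    {z : κ → ι → ℤ} (h : K ≤ AddSubgroup.closure (Set.range z)) :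
    Module.finrank ℤ K ≤ Fintype.card κ := by
  have h' : AddSubgroup.toIntSubmodule K ≤ Submodule.span ℤ (Set.range z) := by
    rw [← AddSubgroup.toIntSubmodule_closure]
    exact AddSubgroup.toIntSubmodule.monotone h
  calc Module.finrank ℤ K = Module.finrank ℤ (AddSubgroup.toIntSubmodule K) := rfl
    _ ≤ _ := Submodule.finrank_mono h'
    _ ≤ _ := finrank_range_le_card z

/-- A lattice containing a nonzero vector has a basis one of whose members is proportional to that
vector, with a positive factor. -/
lemma exists_basis_smul_eq {K : AddSubgroup (ι → ℤ)} [Finite ι] {w : ι → ℤ} (hw : w ∈ K)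
    (hw0 : w ≠ 0) : ∃ z : Fin (Module.finrank ℤ K) → ι → ℤ,
      AddSubgroup.closure (Set.range z) = K ∧ ∃ j, ∃ c : ℤ, 0 < c ∧ w = c • z j := by
  classical
  let w' : K := ⟨w, hw⟩
  -- The Smith normal form of the subgroup generated by `w` makes a nonzero multiple of `w`, hence
  -- `w` itself, proportional to a basis vector.
  obtain ⟨m, snf⟩ := Submodule.smithNormalForm (Module.finBasis ℤ K) (Submodule.span ℤ {w'})
  have hmem : w' ∈ Submodule.span ℤ {w'} := Submodule.mem_span_singleton_self w'
  have hm : 0 < m := by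
    rcases Nat.eq_zero_or_pos m with rfl | h
    · have h : (⟨w', hmem⟩ : Submodule.span ℤ {w'}) = 0 :=
        snf.bN.repr.injective (Subsingleton.elim _ _)
      exact (hw0 (congrArg (fun x : Submodule.span ℤ {w'} => ((x : K) : ι → ℤ)) h)).elim
    · exact h
  set j := snf.f ⟨0, hm⟩ with hj
  have hsnf := snf.snf ⟨0, hm⟩
  obtain ⟨a, ha⟩ := Submodule.mem_span_singleton.1 (snf.bN ⟨0, hm⟩).2
  have ha0 : a ≠ 0 := by
    rintro rfl
    rw [zero_smul] at ha
    exact snf.bN.ne_zero ⟨0, hm⟩ (Subtype.ext ha.symm)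
  have hc : w' = snf.bM.repr w' j • snf.bM j := by
    apply snf.bM.repr.injective
    ext i
    rw [map_smul, Module.Basis.repr_self, Finsupp.smul_single, smul_eq_mul, mul_one,
      Finsupp.single_apply]
    split_ifs with h
    · rw [h]
    · have := congrArg (fun x => snf.bM.repr x i) (ha.trans hsnf)
      simp only [map_smul, Module.Basis.repr_self, Finsupp.smul_apply, smul_eq_mul] at this
      rw [← hj, Finsupp.single_eq_of_ne (Ne.symm h), mul_zero] at this
      exact (mul_eq_zero.1 this).resolve_left ha0
  generalize snf.bM.repr w' j = c at hc
  have hc0 : c ≠ 0 := by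
    rintro rfl
    rw [zero_smul] at hc
    exact hw0 (congrArg Subtype.val hc)
  -- Multiplying the whole basis by a sign makes the factor positive.
  obtain ⟨ε, hε⟩ : ∃ ε : ℤˣ, 0 < (ε : ℤ) * c := by
    rcases lt_or_gt_of_ne hc0 with h | h
    · exact ⟨-1, by simpa using h⟩
    · exact ⟨1, by simpa using h⟩
  let b := snf.bM.unitsSMul fun _ => ε
  refine ⟨fun i => b i, closure_range_basis b, j, ε * c, hε, ?_⟩
  have hb : (b j : ι → ℤ) = (ε : ℤ) • (snf.bM j : ι → ℤ) := by
    rw [Module.Basis.unitsSMul_apply]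
    rfl
  have hεε : (ε : ℤ) * ε = 1 := by rw [← Units.val_mul, Int.units_mul_self, Units.val_one]
  change w = _ • (b j : ι → ℤ)
  rw [hb, smul_smul, mul_right_comm, hεε, one_mul]
  exact congrArg Subtype.val hc

end Lattices

/-! ### Restriction of exponents and specialization of variables -/

section Restriction

variable {ι : Type*}

/-- Restriction of exponent vectors to the variables outside `σ_L`. -/
noncomputable def restrictExp (L : AddSubgroup (ι → ℤ)) : (ι →₀ ℕ) →+ ({i // i ∉ posSupport L} →₀ ℕ) :=
  Finsupp.subtypeDomainAddMonoidHom

lemma restrictExp_apply (L : AddSubgroup (ι → ℤ)) (u : ι →₀ ℕ) (i : {i // i ∉ posSupport L}) :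
    restrictExp L u i = u i.1 := rfl

lemma forget_intVec (L : AddSubgroup (ι → ℤ)) (u : ι →₀ ℕ) :
    forget (posSupport L) (intVec u) = intVec (restrictExp L u) := rfl

lemma latticeCon_restrictExp {L : AddSubgroup (ι → ℤ)} {u v : ι →₀ ℕ}
    (h : intVec u - intVec v ∈ L) :
    intVec (restrictExp L u) - intVec (restrictExp L v) ∈ outerLattice L := by
  rw [← forget_intVec, ← forget_intVec, ← map_sub]
  exact AddSubgroup.mem_map_of_mem _ h

lemma mem_innerLattice_of_restrictExp_eq {L : AddSubgroup (ι → ℤ)} {u v : ι →₀ ℕ}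
    (h : intVec u - intVec v ∈ L) (huv : restrictExp L u = restrictExp L v) :
    intVec u - intVec v ∈ innerLattice L := by
  refine mem_innerLattice.2 ⟨h, fun i hi => ?_⟩
  have : u i = v i := DFunLike.congr_fun huv ⟨i, hi⟩
  simp [this]

/-- Every pair of exponent vectors differing by an element of `L^σ` lifts to a pair differing by an
element of `L`. -/
lemma exists_lift [Finite ι] {L : AddSubgroup (ι → ℤ)} {a b : {i // i ∉ posSupport L} →₀ ℕ}
    (h : intVec a - intVec b ∈ outerLattice L) :
    ∃ u v : ι →₀ ℕ, restrictExp L u = a ∧ restrictExp L v = b ∧ intVec u - intVec v ∈ L := by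
  classical
  obtain ⟨z, hz, hzab⟩ := h
  have hzi : ∀ i (hi : i ∉ posSupport L), z i = a ⟨i, hi⟩ - b ⟨i, hi⟩ :=
    fun i hi => congrFun hzab ⟨i, hi⟩
  refine ⟨Finsupp.equivFunOnFinite.symm fun i =>
      if hi : i ∉ posSupport L then a ⟨i, hi⟩ else (z i).toNat,
    Finsupp.equivFunOnFinite.symm fun i =>
      if hi : i ∉ posSupport L then b ⟨i, hi⟩ else (-z i).toNat, ?_, ?_, ?_⟩
  · ext ⟨i, hi⟩
    rw [restrictExp_apply, Finsupp.equivFunOnFinite_symm_apply_apply, dif_pos hi]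
  · ext ⟨i, hi⟩
    rw [restrictExp_apply, Finsupp.equivFunOnFinite_symm_apply_apply, dif_pos hi]
  · refine (congrArg (· ∈ L) ?_).mpr hz
    ext i
    simp only [Pi.sub_apply, intVec_apply, Finsupp.equivFunOnFinite_symm_apply_apply]
    by_cases hi : i ∉ posSupport L
    · rw [dif_pos hi, dif_pos hi, hzi i hi]
    · rw [dif_neg hi, dif_neg hi]
      omega

/-- The exponent vectors supported in `σ_L`. -/
noncomputable def innerExp (L : AddSubgroup (ι → ℤ)) : AddSubmonoid (ι →₀ ℕ) := AddMonoidHom.mker (restrictExp L)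

lemma mem_innerExp {L : AddSubgroup (ι → ℤ)} {u : ι →₀ ℕ} :
    u ∈ innerExp L ↔ ∀ i, i ∉ posSupport L → u i = 0 := by
  rw [innerExp, AddMonoidHom.mem_mker, DFunLike.ext_iff, Subtype.forall]
  rfl

lemma filter_mem_innerExp {L : AddSubgroup (ι → ℤ)} [DecidablePred (· ∈ posSupport L)]
    (u : ι →₀ ℕ) : u.filter (· ∈ posSupport L) ∈ innerExp L :=
  mem_innerExp.2 fun _ hi => Finsupp.filter_apply_neg _ _ hi

lemma add_filter_eq_add_filter {L : AddSubgroup (ι → ℤ)} [DecidablePred (· ∈ posSupport L)]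
    {u v : ι →₀ ℕ} (h : restrictExp L u = restrictExp L v) :
    u + v.filter (· ∈ posSupport L) = v + u.filter (· ∈ posSupport L) := by
  ext i
  rw [Finsupp.add_apply, Finsupp.add_apply, Finsupp.filter_apply, Finsupp.filter_apply]
  split_ifs with hi
  · exact add_comm _ _
  · have : u i = v i := DFunLike.congr_fun h ⟨i, hi⟩
    rw [this]

lemma restrictExp_add_of_mem {L : AddSubgroup (ι → ℤ)} (u : ι →₀ ℕ) {c : ι →₀ ℕ}
    (hc : c ∈ innerExp L) : restrictExp L (u + c) = restrictExp L u := by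
  rw [map_add, show restrictExp L c = 0 from hc, add_zero]

variable {k : Type*} [Field k]

/-- Setting the variables in `σ_L` to `1`. -/
noncomputable def specialize (k : Type*) [Field k] (L : AddSubgroup (ι → ℤ)) :
    MvPolynomial ι k →+* MvPolynomial {i // i ∉ posSupport L} k :=
  AddMonoidAlgebra.mapDomainRingHom k (restrictExp L)

lemma specialize_monomial (L : AddSubgroup (ι → ℤ)) (u : ι →₀ ℕ) (c : k) :
    specialize k L (monomial u c) = monomial (restrictExp L u) c :=
  AddMonoidAlgebra.mapDomain_single

lemma map_specialize_latticeIdeal [Finite ι] (L : AddSubgroup (ι → ℤ)) :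
    (latticeIdeal k L).map (specialize k L) = latticeIdeal k (outerLattice L) := by
  apply le_antisymm
  · rw [latticeIdeal, Ideal.map_span, Ideal.span_le]
    rintro _ ⟨_, ⟨u, v, huv, rfl⟩, rfl⟩
    rw [map_sub, specialize_monomial, specialize_monomial]
    exact binomial_mem_latticeIdeal.2 (latticeCon_restrictExp huv)
  · rw [latticeIdeal_le_iff]
    intro a b hab
    obtain ⟨u, v, rfl, rfl, huv⟩ := exists_lift hab
    rw [idealCon_iff, ← specialize_monomial, ← specialize_monomial, ← map_sub]
    exact Ideal.mem_map_of_mem _ (binomial_mem_latticeIdeal.2 huv)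

end Restriction

/-! ### From `I_L` to `I_{L^σ}` -/

section Specialization

variable {ι k : Type*} [Field k]

/-- If binomials generate `I_L`, then the vectors of those among them that become trivial outside
`σ_L` generate the part of `L` supported in `σ_L`. -/
lemma innerLattice_le_closure [Finite ι] {L : AddSubgroup (ι → ℤ)} {κ : Type*}
    {u v : κ → ι →₀ ℕ}
    (h : latticeIdeal k L =
      Ideal.span (Set.range fun j => monomial (u j) (1 : k) - monomial (v j) 1)) :
    innerLattice L ≤ AddSubgroup.closure (Set.range
      fun j : {j // intVec (u j) - intVec (v j) ∈ innerLattice L} =>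
        intVec (u j) - intVec (v j)) := by
  classical
  have := Fintype.ofFinite ι
  set Λ := AddSubgroup.closure (Set.range
      fun j : {j // intVec (u j) - intVec (v j) ∈ innerLattice L} =>
        intVec (u j) - intVec (v j)) with hΛ
  have huvL : ∀ j, intVec (u j) - intVec (v j) ∈ L := fun j => by
    rw [← binomial_mem_latticeIdeal (k := k), h]
    exact Ideal.subset_span ⟨j, rfl⟩
  have hadd : ∀ {a b : ι →₀ ℕ}, a + b ∈ innerExp L ↔ a ∈ innerExp L ∧ b ∈ innerExp L := by
    intro a b
    simp only [mem_innerExp, Finsupp.add_apply, Nat.add_eq_zero_iff, imp_and, forall_and]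
  -- The relation never mixes exponents supported in `σ` with others, and constrains differences
  -- only among the former. All generators respect it, and those supported in `σ` have differences
  -- in `Λ`.
  let r : AddCon (ι →₀ ℕ) :=
    { r := fun a b => (a ∈ innerExp L ↔ b ∈ innerExp L) ∧
        (a ∈ innerExp L → intVec a - intVec b ∈ Λ)
      iseqv :=
        { refl := fun a => ⟨Iff.rfl, fun _ => by simp⟩
          symm := fun {a b} h => ⟨h.1.symm, fun hb => by
            simpa using Λ.neg_mem (h.2 (h.1.2 hb))⟩
          trans := fun {a b c} h h' => ⟨h.1.trans h'.1, fun ha => by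
            simpa using Λ.add_mem (h.2 ha) (h'.2 (h.1.1 ha))⟩ }
      add' := fun {a b c d} h h' => ⟨by rw [hadd, hadd, h.1, h'.1], fun hac => by
        rw [map_add, map_add, add_sub_add_comm]
        exact Λ.add_mem (h.2 (hadd.1 hac).1) (h'.2 (hadd.1 hac).2)⟩ }
  have hinner : ∀ {a b : ι →₀ ℕ}, intVec a - intVec b ∈ L → a ∈ innerExp L → b ∈ innerExp L := by
    intro a b hab ha
    have h1 := latticeCon_restrictExp hab
    rw [show restrictExp L a = 0 from ha, map_zero, zero_sub] at h1
    have h2 := eq_zero_of_mem_outerLattice (by simpa using neg_mem h1)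
      (fun i => by simp : 0 ≤ intVec (restrictExp L b))
    exact intVec_injective (h2.trans (map_zero _).symm)
  have hr : ∀ j, r (u j) (v j) := by
    intro j
    refine ⟨⟨hinner (huvL j), hinner (by simpa using L.neg_mem (huvL j))⟩, fun hu => ?_⟩
    have hv := hinner (huvL j) hu
    exact AddSubgroup.subset_closure ⟨⟨j, mem_innerLattice_of_restrictExp_eq (huvL j)
      (hu.trans hv.symm)⟩, rfl⟩
  -- For nonnegative `z` in `L` the binomial `x^z - 1` lies in `I_L`, and its exponent `0` is
  -- supported in `σ`.
  have hpos : ∀ z ∈ L, 0 ≤ z → z ∈ Λ := by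
    intro z hz hz0
    obtain ⟨x, rfl⟩ := exists_intVec_eq hz0
    have h0x : r 0 x := by
      refine rel_of_mem_span (k := k) r (S := Set.range fun j =>
        monomial (u j) (1 : k) - monomial (v j) 1) ?_ ?_
      · rintro _ ⟨j, rfl⟩
        exact ⟨u j, v j, hr j, rfl⟩
      · rw [← h, binomial_mem_latticeIdeal]
        simpa using hz
    simpa using Λ.neg_mem (h0x.2 (innerExp L).zero_mem)
  intro z hz
  obtain ⟨hzL, hz0⟩ := mem_innerLattice.1 hz
  obtain ⟨w, hw, hw0, hwpos⟩ := exists_full_support L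
  set S := ∑ j, |z j| with hS
  have hSn : 0 ≤ S := Finset.sum_nonneg fun j _ => abs_nonneg (z j)
  -- A vector of `K` is a difference of two nonnegative vectors of `L`: `z = (z + S • w) - S • w`.
  have h1 : z + S • w ∈ Λ := by
    refine hpos _ (L.add_mem hzL (L.zsmul_mem hw _)) fun j => ?_
    simp only [Pi.zero_apply, Pi.add_apply, Pi.smul_apply, smul_eq_mul]
    by_cases hj : j ∈ posSupport L
    · have := hwpos j hj
      have h1 := neg_abs_le (z j)
      have h2 : |z j| ≤ S :=
        Finset.single_le_sum (f := fun j => |z j|) (fun j _ => abs_nonneg (z j)) (Finset.mem_univ j)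
      nlinarith
    · rw [hz0 j hj, zero_add]
      exact mul_nonneg hSn (hw0 j)
  have h2 : S • w ∈ Λ := Λ.zsmul_mem (hpos w hw hw0) _
  simpa using Λ.sub_mem h1 h2

lemma exists_fin_generators {R : Type*} [CommRing R] {κ : Type*} [Fintype κ] {m : ℕ}
    (hm : Fintype.card κ ≤ m) (g : κ → R) :
    ∃ P : Fin m → R, Ideal.span (Set.range g) = Ideal.span (Set.range P) := by
  obtain ⟨e⟩ := Function.Embedding.nonempty_of_card_le (hm.trans_eq (Fintype.card_fin m).symm)
  refine ⟨Function.extend e g 0, le_antisymm ?_ ?_⟩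
  · rw [Ideal.span_le]
    rintro _ ⟨x, rfl⟩
    exact Ideal.subset_span ⟨e x, e.injective.extend_apply _ _ _⟩
  · rw [Ideal.span_le]
    rintro _ ⟨j, rfl⟩
    by_cases hj : ∃ x, e x = j
    · obtain ⟨x, rfl⟩ := hj
      rw [e.injective.extend_apply]
      exact Ideal.subset_span ⟨x, rfl⟩
    · rw [Function.extend_apply' _ _ _ hj]
      exact Ideal.zero_mem _

lemma isCompleteIntersection_outer [Finite ι] {L : AddSubgroup (ι → ℤ)}
    (h : IsBinomialCompleteIntersection (latticeIdeal k L)) :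
    IsCompleteIntersection (latticeIdeal k (outerLattice L)) := by
  classical
  have := Fintype.ofFinite ι
  obtain ⟨r, B, hB, hr, hspan⟩ := h
  choose u v huv using hB
  obtain rfl : B = fun j => monomial (u j) 1 - monomial (v j) 1 := funext huv
  rw [height_latticeIdeal, Nat.cast_inj, finrank_eq_outer_add_inner] at hr
  let p : Fin r → Prop := fun j => intVec (u j) - intVec (v j) ∈ innerLattice L
  have hT : _ ≤ Fintype.card {j // p j} :=
    finrank_le_card_of_le_closure (innerLattice_le_closure hspan)
  have hcard : Fintype.card {j // ¬ p j} ≤ Module.finrank ℤ (outerLattice L) := by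
    rw [Fintype.card_subtype_compl, Fintype.card_fin]
    omega
  obtain ⟨P, hP⟩ := exists_fin_generators hcard fun j =>
    specialize k L (monomial (u j) 1 - monomial (v j) 1)
  refine ⟨_, P, height_latticeIdeal _, ?_⟩
  rw [← hP, ← map_specialize_latticeIdeal, hspan, Ideal.map_span, ← Set.range_comp]
  apply le_antisymm
  · rw [Ideal.span_le]
    rintro _ ⟨j, rfl⟩
    by_cases hj : p j
    · have hres : restrictExp L (u j) = restrictExp L (v j) := by
        ext i
        have := (mem_innerLattice.1 hj).2 i.1 i.2
        rw [Pi.sub_apply, sub_eq_zero, intVec_apply, intVec_apply] at this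
        exact_mod_cast this
      simp only [Function.comp_apply, map_sub, specialize_monomial, hres, sub_self]
      exact Ideal.zero_mem _
    · exact Ideal.subset_span ⟨⟨j, hj⟩, rfl⟩
  · refine Ideal.span_mono ?_
    rintro _ ⟨j, rfl⟩
    exact ⟨j.1, rfl⟩

end Specialization

/-! ### From `I_{L^σ}` to `I_L` -/

section Lifting

variable {ι k : Type*} [Field k]

/-- The part of `L` supported in `σ_L` is generated by as many binomial exponents as its rank, in
such a way that identifying their two sides makes the variables in `σ_L` invertible. -/
lemma exists_inner_generators [Finite ι] (L : AddSubgroup (ι → ℤ)) :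
    ∃ u v : Fin (Module.finrank ℤ (innerLattice L)) → ι →₀ ℕ,
      (∀ j, u j ∈ innerExp L ∧ v j ∈ innerExp L) ∧
      AddSubgroup.closure (Set.range fun j => intVec (u j) - intVec (v j)) = innerLattice L ∧
      ∀ r : AddCon (ι →₀ ℕ), (∀ j, r (u j) (v j)) → ∃ W, r W 0 ∧ ∀ i ∈ posSupport L, W i ≠ 0 := by
  obtain ⟨w, hw, hw0, hpos⟩ := exists_full_support L
  have hwK : w ∈ innerLattice L :=
    mem_innerLattice.2 ⟨hw, fun i hi => eq_zero_of_notMem_posSupport hw hw0 hi⟩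
  obtain ⟨z, hz, hzw⟩ : ∃ z : Fin (Module.finrank ℤ (innerLattice L)) → ι → ℤ,
      AddSubgroup.closure (Set.range z) = innerLattice L ∧
        (w ≠ 0 → ∃ j, ∃ c : ℤ, 0 < c ∧ w = c • z j) := by
    by_cases h : w = 0
    · exact ⟨fun j => Module.finBasis ℤ (innerLattice L) j, closure_range_basis _,
        fun h' => (h' h).elim⟩
    · obtain ⟨z, hz, hzw⟩ := exists_basis_smul_eq hwK h
      exact ⟨z, hz, fun _ => hzw⟩
  choose u v huv hsupp using fun j => exists_intVec_sub_eq (z j)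
  refine ⟨u, v, fun j => ?_, by simpa only [huv] using hz, fun r hr => ?_⟩
  · have hzj : z j ∈ innerLattice L := hz ▸ AddSubgroup.subset_closure ⟨j, rfl⟩
    have h0 := (mem_innerLattice.1 hzj).2
    exact ⟨mem_innerExp.2 fun i hi => (hsupp j i).1 (h0 i hi).le,
      mem_innerExp.2 fun i hi => (hsupp j i).2 (h0 i hi).ge⟩
  · by_cases h : w = 0
    · refine ⟨0, r.refl 0, fun i hi => ?_⟩
      have := hpos i hi
      simp [h] at this
    · obtain ⟨j, c, hc, hwc⟩ := hzw h
      have hzi : ∀ i, w i = c * z j i := fun i => by rw [hwc]; rfl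
      have hz0 : ∀ i, 0 ≤ z j i := fun i => by
        have := hw0 i
        rw [hzi i] at this
        exact nonneg_of_mul_nonneg_right this hc
      -- The basis vector `z j` is a positive fraction of `w`, so it is nonnegative and its binomial
      -- is `x^(u j) - 1`.
      have hv : v j = 0 := by
        ext i
        exact (hsupp j i).2 (hz0 i)
      refine ⟨u j, hv ▸ hr j, fun i hi hui => ?_⟩
      have h1 := hpos i hi
      have h2 := congrFun (huv j) i
      rw [hzi i, ← h2, Pi.sub_apply, intVec_apply, intVec_apply, hui, hv] at h1
      simp at h1

/-- In a congruence that identifies a monomial of full support in `σ_L` with `1`, monomials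
supported in `σ_L` can be cancelled. -/
lemma cancel_of_mem_innerExp {L : AddSubgroup (ι → ℤ)} (r : AddCon (ι →₀ ℕ)) {W : ι →₀ ℕ}
    (hW : r W 0) (hsupp : ∀ i ∈ posSupport L, W i ≠ 0) {c : ι →₀ ℕ} (hc : c ∈ innerExp L)
    {u v : ι →₀ ℕ} (h : r (u + c) (v + c)) : r u v := by
  have hN : r (c.degree • W) 0 := by simpa using r.nsmul c.degree hW
  -- Thus `x^c` divides a power of `x^W`, which is congruent to `1`, so `x^c` is invertible in the
  -- quotient monoid.
  have hle : c ≤ c.degree • W := by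
    intro i
    by_cases hi : i ∈ posSupport L
    · calc c i ≤ c.degree := Finsupp.le_degree i c
        _ = c.degree * 1 := (mul_one _).symm
        _ ≤ c.degree * W i := by
          gcongr
          exact Nat.one_le_iff_ne_zero.2 (hsupp i hi)
    · rw [mem_innerExp.1 hc i hi]
      exact Nat.zero_le _
  obtain ⟨d, hd⟩ := exists_add_of_le hle
  have h1 : ∀ x : ι →₀ ℕ, r x (x + c + d) := fun x => by
    rw [add_assoc, ← hd]
    simpa using r.add (r.refl x) (r.symm hN)
  exact r.trans (h1 u) (r.trans (r.add h (r.refl d)) (r.symm (h1 v)))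

/-- Lifts of binomial generators of `I_{L^σ}` together with binomials for generators of the part of
`L` supported in `σ_L` generate `I_L`. -/
lemma latticeIdeal_le_of_lifts [Finite ι] {L : AddSubgroup (ι → ℤ)}
    {I : Ideal (MvPolynomial ι k)} (hI : I ≤ latticeIdeal k L) {κ : Type*} {u v : κ → ι →₀ ℕ}
    (huv : ∀ j, idealCon I (u j) (v j))
    (hgen : latticeIdeal k (outerLattice L) = Ideal.span (Set.range fun j =>
      monomial (restrictExp L (u j)) (1 : k) - monomial (restrictExp L (v j)) 1))
    {κ' : Type*} {u' v' : κ' → ι →₀ ℕ} (huv' : ∀ j, idealCon I (u' j) (v' j))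
    (hinner : ∀ j, u' j ∈ innerExp L ∧ v' j ∈ innerExp L)
    (hclosure : AddSubgroup.closure (Set.range fun j => intVec (u' j) - intVec (v' j)) =
      innerLattice L)
    (hunit : ∃ W, idealCon I W 0 ∧ ∀ i ∈ posSupport L, W i ≠ 0) :
    latticeIdeal k L ≤ I := by
  classical
  obtain ⟨W, hW, hWsupp⟩ := hunit
  set r := idealCon I with hr
  have hcancel : ∀ c ∈ innerExp L, ∀ x y, r (x + c) (y + c) → r x y :=
    fun c hc x y h => cancel_of_mem_innerExp r hW hWsupp hc h
  have hK : ∀ {x y : ι →₀ ℕ}, intVec x - intVec y ∈ innerLattice L → r x y := by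
    intro x y hxy
    refine rel_of_mem_closure r (innerExp L) hcancel
      (Z := Set.range fun j => intVec (u' j) - intVec (v' j)) ?_ (hclosure ▸ hxy)
    rintro _ ⟨j, rfl⟩
    exact ⟨u' j, (hinner j).1, v' j, (hinner j).2, rfl, huv' j⟩
  have hsurj : ∀ a, ∃ x, restrictExp L x = a := fun a => by
    obtain ⟨x, -, hx, -⟩ := exists_lift (L := L) (a := a) (b := a) (by simp)
    exact ⟨x, hx⟩
  -- This is the image of `r` under restriction. For transitivity, two lifts of the middle term
  -- agree after each is padded with the `σ`-part of the other.
  let ρ : AddCon ({i // i ∉ posSupport L} →₀ ℕ) :=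
    { r := fun a b => ∃ x y, restrictExp L x = a ∧ restrictExp L y = b ∧ r x y
      iseqv :=
        { refl := fun a => by
            obtain ⟨x, hx⟩ := hsurj a
            exact ⟨x, x, hx, hx, r.refl x⟩
          symm := fun ⟨x, y, hx, hy, h⟩ => ⟨y, x, hy, hx, r.symm h⟩
          trans := fun ⟨x, y, hx, hy, h⟩ ⟨y', z, hy', hz, h'⟩ => by
            refine ⟨x + y'.filter (· ∈ posSupport L), z + y.filter (· ∈ posSupport L), ?_, ?_, ?_⟩
            · rw [restrictExp_add_of_mem _ (filter_mem_innerExp _), hx]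
            · rw [restrictExp_add_of_mem _ (filter_mem_innerExp _), hz]
            · refine r.trans (r.add h (r.refl _)) ?_
              rw [add_filter_eq_add_filter (hy.trans hy'.symm)]
              exact r.add h' (r.refl _) }
      add' := fun ⟨x, y, hx, hy, h⟩ ⟨x', y', hx', hy', h'⟩ =>
        ⟨x + x', y + y', by rw [map_add, hx, hx'], by rw [map_add, hy, hy'], r.add h h'⟩ }
  rw [latticeIdeal_le_iff]
  intro x y hxy
  rw [latticeCon_iff] at hxy
  have hρ : ρ (restrictExp L x) (restrictExp L y) := by
    refine rel_of_mem_span (k := k) ρ (S := Set.range fun j =>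
      monomial (restrictExp L (u j)) (1 : k) - monomial (restrictExp L (v j)) 1) ?_ ?_
    · rintro _ ⟨j, rfl⟩
      exact ⟨_, _, ⟨u j, v j, rfl, rfl, huv j⟩, rfl⟩
    · rw [← hgen, binomial_mem_latticeIdeal]
      exact latticeCon_restrictExp hxy
  obtain ⟨x', y', hx', hy', h'⟩ := hρ
  have hL' : intVec x' - intVec y' ∈ L := binomial_mem_latticeIdeal.1 (hI h')
  have hxx' := add_filter_eq_add_filter hx'.symm
  -- Writing `c_σ` for the part of `c` in `σ`: `x + x'_σ = x' + x_σ` is related to `y' + x_σ` by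
  -- `h'`, and that to `y + x'_σ` because their difference lies in `K`; then `x'_σ` cancels.
  refine hcancel _ (filter_mem_innerExp x') x y ?_
  rw [hxx']
  refine r.trans (r.add h' (r.refl _)) (hK (mem_innerLattice_of_restrictExp_eq ?_ ?_))
  · have := congrArg intVec hxx'
    rw [map_add, map_add] at this
    have h2 : intVec (y' + x.filter (· ∈ posSupport L)) -
        intVec (y + x'.filter (· ∈ posSupport L)) =
          (intVec x - intVec y) - (intVec x' - intVec y') := by
      rw [map_add, map_add, ← sub_eq_zero]
      rw [← sub_eq_zero] at this
      rw [← neg_eq_zero, ← this]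
      abel
    rw [h2]
    exact L.sub_mem hxy hL'
  · rw [restrictExp_add_of_mem _ (filter_mem_innerExp _),
      restrictExp_add_of_mem _ (filter_mem_innerExp _), hy']

lemma isBinomialCompleteIntersection_of_outer [Finite ι] {L : AddSubgroup (ι → ℤ)}
    (h : IsCompleteIntersection (latticeIdeal k (outerLattice L))) :
    IsBinomialCompleteIntersection (latticeIdeal k L) := by
  classical
  have := Fintype.ofFinite ι
  obtain ⟨m, P, hm, hP⟩ := h
  rw [height_latticeIdeal, Nat.cast_inj] at hm
  obtain ⟨a, b, hab, hspan⟩ :=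
    exists_binomial_generators (fun w hw => eq_zero_of_mem_outerLattice hw) hP
  choose u v hua hvb huv using fun j => exists_lift (hab j)
  obtain ⟨u', v', hinner, hclosure, hunit⟩ := exists_inner_generators L
  let g : Fin m ⊕ Fin (Module.finrank ℤ (innerLattice L)) → MvPolynomial ι k :=
    Sum.elim (fun j => monomial (u j) 1 - monomial (v j) 1)
      (fun j => monomial (u' j) 1 - monomial (v' j) 1)
  have hinl : ∀ j, idealCon (Ideal.span (Set.range g)) (u j) (v j) :=
    fun j => Ideal.subset_span ⟨Sum.inl j, rfl⟩
  have hinr : ∀ j, idealCon (Ideal.span (Set.range g)) (u' j) (v' j) :=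
    fun j => Ideal.subset_span ⟨Sum.inr j, rfl⟩
  have hle : Ideal.span (Set.range g) ≤ latticeIdeal k L := by
    rw [Ideal.span_le]
    rintro _ ⟨j | j, rfl⟩
    · exact binomial_mem_latticeIdeal.2 (huv j)
    · refine binomial_mem_latticeIdeal.2 (mem_innerLattice.1 ?_).1
      rw [← hclosure]
      exact AddSubgroup.subset_closure ⟨j, rfl⟩
  refine ⟨m + Module.finrank ℤ (innerLattice L), g ∘ finSumFinEquiv.symm, fun j => ?_, ?_, ?_⟩
  · rw [Function.comp_apply]
    rcases finSumFinEquiv.symm j with j | j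
    · exact ⟨u j, v j, rfl⟩
    · exact ⟨u' j, v' j, rfl⟩
  · rw [height_latticeIdeal, finrank_eq_outer_add_inner, hm]
  · rw [EquivLike.range_comp]
    refine le_antisymm ?_ hle
    refine latticeIdeal_le_of_lifts hle hinl ?_ hinr hinner hclosure (hunit _ hinr)
    simpa only [hua, hvb] using hspan

end Lifting

end LatticeIdeal

theorem theorem5p5 {k : Type*} [Field k] (n : ℕ) (L : AddSubgroup (Fin n → ℤ)) :
    LatticeIdeal.IsBinomialCompleteIntersection (LatticeIdeal.latticeIdeal k L) ↔
      LatticeIdeal.IsCompleteIntersection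
        (LatticeIdeal.latticeIdeal k (LatticeIdeal.outerLattice L)) :=
  ⟨LatticeIdeal.isCompleteIntersection_outer,
    LatticeIdeal.isBinomialCompleteIntersection_of_outer⟩
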